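/- Let $n\ge 0$ and $d\ge 3$ be integers and let $S^d(\mathbb R^n)$ be the space of real symmetric $n\times\cdots\times n$ tensors of order $d$. Put $$V_{\mathrm{diag}}=\{T\in S^d(\mathbb R^n) : T_{i_1\dots i_d}\ne 0 \text{ only if } i_1=\dots=i_d\},\qquad V_{\mathrm{pmi}}=\{T\in S^d(\mathbb R^n) : T_{ij\dots j}=0 \text{ for all } i\ne j\},$$ and let $V$ be a linear space with $V_{\mathrm{diag}}\subseteq V\subseteq V_{\mathrm{pmi}}$. For a random vector $z$ in $\mathbb R^n$ with finite moments of order $d$, let $\kappa_d(z)\in S^d(\mathbb R^n)$ be its $d$-th cumulant tensor, with entries $$\kappa_d(z)_{i_1\dots i_d}=\sum_{\pi}(-1)^{|\pi|-1}(|\pi|-1)!\prod_{B\in\pi}\mathbb E\Big(\prod_{k\in B}z_{i_k}\Big),$$ the sum being over all set partitions $\pi$ of $\{1,\dots,d\}$. **Theorem 1.3.** There is a real polynomial $p$ in the entries of a tensor, not vanishing identically on $V$ (and depending only on $n$, $d$, $V$), such that the following holds. Let $x=As$, where $A\in\mathbb R^{n\times n}$ is invertible and $s$ is a random vector with finite moments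 of order $d$, $\operatorname{Cov}(s)=I$, $\kappa_d(s)\in V$ and $p(\kappa_d(s))\ne 0$ (that is, $\kappa_d(s)$ is sufficiently general in $V$). Then $A$ is identifiable from $\kappa_d(x)$ together with the covariance matrix $\operatorname{Cov}(x)$, up to permutation and sign flips of columns: if $B\in\mathbb R^{n\times n}$ is invertible and $s'$ is any random vector, possibly on another probability space, with finite moments of order $d$, $\operatorname{Cov}(s')=I$ and $\kappa_d(s')\in V$, such that $\operatorname{Cov}(Bs')=\operatorname{Cov}(As)$ and $\kappa_d(Bs')=\kappa_d(As)$, then $B$ is obtained from $A$ by permuting columns and changing the signs of some columns. -/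

import Mathlib

open MeasureTheory

namespace ComponentAnalysis

/-- Real tensors of order `d` and format `n × ⋯ × n`. -/
abbrev Tensor (n d : ℕ) : Type := (Fin d → Fin n) → ℝ

/-- The linear space `S^d(ℝⁿ)` of symmetric tensors. -/
def symSpace (n d : ℕ) : Submodule ℝ (Tensor n d) where
  carrier := {T | ∀ (σ : Equiv.Perm (Fin d)) (i : Fin d → Fin n), T (i ∘ σ) = T i}
  add_mem' := fun {a b} ha hb σ i => by simp only [Pi.add_apply, ha σ i, hb σ i]
  zero_mem' := fun _ _ => rfl
  smul_mem' := fun c a ha σ i => by simp only [Pi.smul_apply, ha σ i]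

/-- `V_diag`: the symmetric tensors with `T_{i₁…i_d} ≠ 0` only if `i₁ = ⋯ = i_d`. -/
def diagSpace (n d : ℕ) : Submodule ℝ (Tensor n d) where
  carrier := {T | T ∈ symSpace n d ∧ ∀ i : Fin d → Fin n, T i ≠ 0 → ∀ k l, i k = i l}
  add_mem' := fun {a b} ha hb => by
    refine ⟨add_mem ha.1 hb.1, fun i hi => ?_⟩
    by_cases h : a i = 0
    · refine hb.2 i fun h' => hi ?_
      simp [h, h']
    · exact ha.2 i h
  zero_mem' := ⟨zero_mem _, fun _ hi => (hi rfl).elim⟩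
  smul_mem' := fun c a ha => by
    refine ⟨Submodule.smul_mem _ c ha.1, fun i hi => ha.2 i fun h => hi ?_⟩
    simp [h]

/-- The multi-index `(i, j, …, j)` of length `d`. -/
def pmiIndex {n : ℕ} (d : ℕ) (i j : Fin n) : Fin d → Fin n :=
  fun k => if (k : ℕ) = 0 then i else j

/-- `V_pmi`: the symmetric tensors with `T_{ij…j} = 0` for all `i ≠ j`. -/
def pmiSpace (n d : ℕ) : Submodule ℝ (Tensor n d) where
  carrier := {T | T ∈ symSpace n d ∧ ∀ i j : Fin n, i ≠ j → T (pmiIndex d i j) = 0}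
  add_mem' := fun {a b} ha hb =>
    ⟨add_mem ha.1 hb.1, fun i j h => by simp [ha.2 i j h, hb.2 i j h]⟩
  zero_mem' := ⟨zero_mem _, fun _ _ _ => rfl⟩
  smul_mem' := fun c a ha =>
    ⟨Submodule.smul_mem _ c ha.1, fun i j h => by simp [ha.2 i j h]⟩

/-- A property of tensors holds for all sufficiently general elements of the linear space `V`: there
is a polynomial in the tensor entries, not vanishing identically on `V`, such that the property
holds at every `T ∈ V` at which the polynomial is nonzero. -/
def ForGeneric {n d : ℕ} (V : Submodule ℝ (Tensor n d)) (P : Tensor n d → Prop) : Prop :=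
  ∃ p : MvPolynomial (Fin d → Fin n) ℝ,
    (∃ T ∈ V, MvPolynomial.eval T p ≠ 0) ∧ ∀ T ∈ V, MvPolynomial.eval T p ≠ 0 → P T

section RandomVectors

variable {Ω : Type*} [MeasurableSpace Ω]

/-- The covariance matrix of a random vector. -/
noncomputable def covMatrix {n : ℕ} (μ : Measure Ω) (z : Ω → Fin n → ℝ) :
    Matrix (Fin n) (Fin n) ℝ :=
  Matrix.of fun i j => ProbabilityTheory.covariance (fun ω => z ω i) (fun ω => z ω j) μ

/-- The `d`-th cumulant tensor of a random vector with finite moments of order `d`: the entry at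
`(i₁, …, i_d)` is `∑_π (-1)^(|π|-1) (|π|-1)! ∏_{B ∈ π} E (∏_{k ∈ B} z_{i_k})`, where `π` runs over
the set partitions of `{1, …, d}`. -/
noncomputable def cumulant {n : ℕ} (d : ℕ) (μ : Measure Ω) (z : Ω → Fin n → ℝ) : Tensor n d :=
  fun i => ∑ π : Finpartition (Finset.univ : Finset (Fin d)),
    (-1 : ℝ) ^ (π.parts.card - 1) * ((π.parts.card - 1).factorial : ℝ) *
      ∏ B ∈ π.parts, ∫ ω, ∏ k ∈ B, z ω (i k) ∂μ

/-- The sources of the component analysis model given by `V`: random vectors with finite moments of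
order `d`, identity covariance matrix, and `d`-th cumulant tensor in `V`. -/
structure IsSource {n d : ℕ} (V : Submodule ℝ (Tensor n d)) (μ : Measure Ω)
    (s : Ω → Fin n → ℝ) : Prop where
  memLp : ∀ i, MemLp (fun ω => s ω i) d μ
  cov_eq_one : covMatrix μ s = 1
  cumulant_mem : cumulant d μ s ∈ V

end RandomVectors

/-- `B` is obtained from `A` by permuting columns and flipping signs of columns. -/
def EqUpToSignedPerm {n : ℕ} (A B : Matrix (Fin n) (Fin n) ℝ) : Prop :=
  ∃ (σ : Equiv.Perm (Fin n)) (ε : Fin n → ℝ),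
    (∀ j, ε j = 1 ∨ ε j = -1) ∧ ∀ i j, B i j = ε j * A i (σ j)

end ComponentAnalysis

/-!
The equality of covariances says `B = A * Q` with `Q` orthogonal, and the equality of cumulants says
that `Qᵀ` maps `T = κ_d(s)` to a tensor in `V_pmi`. The latter means that the columns of `Q` are an
orthonormal basis of eigenvectors of `T`, so it suffices that for general `T` in `V_pmi` the only
such bases are the signed permutations of the standard basis.

Suppose column `a` of such a `Q` is not a multiple of a standard basis vector. Then `Q` satisfies
equations that are homogeneous in `Q`: the eigenvector equations, `Qᵀ * Q` is scalar, and for each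
`j` a determinant, zero because `e_j` is an eigenvector of `T` as well, that is nonzero at multiples
of `e_j` for good `T`. By elimination theory, if these equations have only the solution `Q = 0` over
`ℂ` for one tensor, then they do so for a general one. The tensor can be diagonal, with weights such
that the moduli of the nonzero coordinates of an eigenvector are proportional to powers of `2`. The
terms of `∑ u k * v k` then have moduli proportional to powers of `4`, hence cannot cancel, and
orthogonal eigenvectors have disjoint supports.
-/

namespace ComponentAnalysis

section Elimination

open MvPolynomial

attribute [local instance] gradedAlgebra

variable {σ ι : Type*}

theorem exists_isHomogeneous_imp_mem_of_forall_eval_eq_zero {K : Type*} [Field K] [IsAlgClosed K]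
    [Finite ι] (J : Ideal (MvPolynomial ι K))
    (hJ : ∀ x : ι → K, (∀ f ∈ J, eval x f = 0) → x = 0) :
    ∃ N : ℕ, ∀ f : MvPolynomial ι K, f.IsHomogeneous N → f ∈ J := by
  have hrad : idealOfVars ι K ≤ J.radical := by
    rw [← vanishingIdeal_zeroLocus_eq_radical (K := K), idealOfVars, Ideal.span_le]
    rintro _ ⟨i, rfl⟩ x hx
    have : x = 0 := hJ x fun f hf => by simpa [aeval_eq_eval] using hx f hf
    simp [this]
  obtain ⟨N, hN⟩ := J.exists_radical_pow_le_of_fg (IsNoetherian.noetherian _)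
  refine ⟨N, fun f hf => hN (Ideal.pow_right_mono hrad N ?_)⟩
  rw [mem_pow_idealOfVars_iff']
  exact fun x hx => hf.coeff_eq_zero hx.ne

theorem mem_smul_homogeneousSubmodule {R : Type*} [CommRing R] (I : Ideal R) (N : ℕ)
    {f : MvPolynomial ι R} (hf : f.IsHomogeneous N) (hI : ∀ m, coeff m f ∈ I) :
    f ∈ I • homogeneousSubmodule ι R N := by
  rw [f.as_sum]
  refine Submodule.sum_mem _ fun m hm => ?_
  rw [← mul_one (coeff m f), ← smul_eq_mul, ← smul_monomial]
  refine Submodule.smul_mem_smul (hI m) (isHomogeneous_monomial _ ?_)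
  by_contra hne
  exact mem_support_iff.1 hm (hf.coeff_eq_zero hne)

section

variable {R S : Type*} [CommRing R] [CommRing S] {φ : R →+* S} {J : Ideal (MvPolynomial ι R)}
  {N : ℕ}

theorem exists_mem_sub_mem_ker_smul_homogeneousSubmodule (hφ : Function.Surjective φ)
    (hJ : J.IsHomogeneous (homogeneousSubmodule ι R)) {f : MvPolynomial ι R}
    (hf : f.IsHomogeneous N) (hfJ : map φ f ∈ J.map (map φ)) :
    ∃ g ∈ J, f - g ∈ RingHom.ker φ • homogeneousSubmodule ι R N := by
  obtain ⟨g, hgJ, hg⟩ := (Ideal.mem_map_iff_of_surjective _ (map_surjective φ hφ)).1 hfJ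
  refine ⟨homogeneousComponent N g, homogeneousComponent_mem_of_mem hJ hgJ N,
    mem_smul_homogeneousSubmodule _ _ (hf.sub (homogeneousComponent_isHomogeneous N g))
      fun m => ?_⟩
  rw [RingHom.mem_ker, coeff_sub, coeff_homogeneousComponent]
  split_ifs with hm
  · rw [map_sub, ← coeff_map, ← coeff_map, hg, sub_self]
  · rw [hf.coeff_eq_zero hm, sub_zero, map_zero]

theorem exists_smul_mem_of_isHomogeneous [Finite ι] (hφ : Function.Surjective φ)
    (hJ : J.IsHomogeneous (homogeneousSubmodule ι R))
    (hN : ∀ f : MvPolynomial ι S, f.IsHomogeneous N → f ∈ J.map (map φ)) :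
    ∃ r, φ r = 1 ∧ ∀ f : MvPolynomial ι R, f.IsHomogeneous N → r • f ∈ J := by
  let q := (J.restrictScalars R).mkQ
  let H := (homogeneousSubmodule ι R N).map q
  have hle : H ≤ RingHom.ker φ • H := by
    rw [← Submodule.map_smul'']
    rintro _ ⟨f, hf : f.IsHomogeneous N, rfl⟩
    obtain ⟨g, hgJ, hg⟩ :=
      exists_mem_sub_mem_ker_smul_homogeneousSubmodule hφ hJ hf (hN _ (hf.map φ))
    refine ⟨f - g, hg, ?_⟩
    rw [map_sub, sub_eq_self]
    exact (Submodule.Quotient.mk_eq_zero _).2 hgJ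
  obtain ⟨r, hr, hrH⟩ := Submodule.exists_sub_one_mem_and_smul_eq_zero_of_fg_of_le_smul _
    H ((homogeneousSubmodule_fg _ _ N).map q) hle
  refine ⟨r, ?_, fun f hf => ?_⟩
  · rw [← sub_eq_zero, ← map_one φ, ← map_sub]
    exact hr
  · exact (Submodule.Quotient.mk_eq_zero (J.restrictScalars R)).1 (hrH (q f) ⟨f, hf, rfl⟩)

end

/-- The evaluation of a polynomial system with parameters at the parameter values `t` and the
unknowns `x`. -/
noncomputable def evalAt {R : Type*} [CommRing R] (t : σ → R) (x : ι → R) :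
    MvPolynomial ι (MvPolynomial σ R) →+* R :=
  (eval x).comp (map (eval t))

theorem exists_eliminant {K α : Type*} [Field K] [IsAlgClosed K] [Finite ι]
    (F : α → MvPolynomial ι (MvPolynomial σ K)) (hF : ∀ a, ∃ k, (F a).IsHomogeneous k)
    (t₀ : σ → K) (ht₀ : ∀ x : ι → K, (∀ a, evalAt t₀ x (F a) = 0) → x = 0) :
    ∃ p : MvPolynomial σ K, eval t₀ p ≠ 0 ∧ ∀ (t : σ → K) (x : ι → K), eval t p ≠ 0 →
      (∀ a, evalAt t x (F a) = 0) → x = 0 := by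
  let J := Ideal.span (Set.range F)
  have hJ : J.IsHomogeneous (homogeneousSubmodule ι (MvPolynomial σ K)) :=
    Ideal.homogeneous_span _ _ (by rintro _ ⟨a, rfl⟩; exact hF a)
  obtain ⟨N, hN⟩ := exists_isHomogeneous_imp_mem_of_forall_eval_eq_zero (J.map (map (eval t₀)))
    fun x hx => ht₀ x fun a => hx _ (Ideal.mem_map_of_mem _ (Ideal.subset_span ⟨a, rfl⟩))
  obtain ⟨p, hp₁, hp⟩ :=
    exists_smul_mem_of_isHomogeneous (fun c => ⟨C c, eval_C c⟩) hJ hN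
  refine ⟨p, hp₁ ▸ one_ne_zero, fun t x ht hx => funext fun i => ?_⟩
  have hker : J ≤ RingHom.ker (evalAt t x) :=
    Ideal.span_le.2 (Set.forall_mem_range.2 hx)
  have hpX : eval t p * x i ^ N = 0 := by
    simpa [evalAt, smul_eq_C_mul] using hker (hp (X i ^ N) (isHomogeneous_X_pow i N))
  exact eq_zero_of_pow_eq_zero ((mul_eq_zero.1 hpX).resolve_left ht)

theorem exists_eval_eq_re (p : MvPolynomial σ ℂ) :
    ∃ q : MvPolynomial σ ℝ, ∀ t : σ → ℝ, eval t q = (eval (fun i => (t i : ℂ)) p).re := by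
  induction p using MvPolynomial.induction_on with
  | C a => exact ⟨C a.re, fun t => by simp⟩
  | add p₁ p₂ h₁ h₂ =>
    obtain ⟨q₁, h₁⟩ := h₁
    obtain ⟨q₂, h₂⟩ := h₂
    exact ⟨q₁ + q₂, fun t => by simp [h₁, h₂]⟩
  | mul_X p i h =>
    obtain ⟨q, h⟩ := h
    exact ⟨q * X i, fun t => by simp [h]⟩

theorem exists_real_eval_ne_zero (p : MvPolynomial σ ℂ) (t₀ : σ → ℝ)
    (ht₀ : eval (fun i => (t₀ i : ℂ)) p ≠ 0) :
    ∃ q : MvPolynomial σ ℝ, eval t₀ q ≠ 0 ∧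
      ∀ t : σ → ℝ, eval t q ≠ 0 → eval (fun i => (t i : ℂ)) p ≠ 0 := by
  obtain ⟨q, hq⟩ := exists_eval_eq_re (C (eval (fun i => (t₀ i : ℂ)) p)⁻¹ * p)
  refine ⟨q, by simp [hq, ht₀], fun t ht h0 => ht ?_⟩
  simp [hq, h0]

end Elimination

section Cumulants

variable {Ω : Type*} [MeasurableSpace Ω] {μ : Measure Ω}

theorem IsSource.mono {n d : ℕ} {V W : Submodule ℝ (Tensor n d)} (hVW : V ≤ W)
    {s : Ω → Fin n → ℝ} (hs : IsSource V μ s) : IsSource W μ s :=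
  ⟨hs.memLp, hs.cov_eq_one, hVW hs.cumulant_mem⟩

theorem IsSource.memLp_two {n d : ℕ} [IsFiniteMeasure μ] {V : Submodule ℝ (Tensor n d)}
    {s : Ω → Fin n → ℝ} (hs : IsSource V μ s) (hd : 2 ≤ d) (i : Fin n) :
    MemLp (fun ω => s ω i) 2 μ :=
  (hs.memLp i).mono_exponent (by exact_mod_cast hd)

theorem covMatrix_mulVec {m n : ℕ} [IsFiniteMeasure μ] (M : Matrix (Fin m) (Fin n) ℝ)
    {z : Ω → Fin n → ℝ} (hz : ∀ i, MemLp (fun ω => z ω i) 2 μ) :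
    covMatrix μ (fun ω => M.mulVec (z ω)) = M * covMatrix μ z * M.transpose := by
  ext i j
  simp only [covMatrix, Matrix.of_apply, Matrix.mulVec, dotProduct, Matrix.mul_apply,
    Matrix.transpose_apply]
  rw [ProbabilityTheory.covariance_fun_sum_fun_sum (fun k => (hz k).const_mul (M i k))
    (fun k => (hz k).const_mul (M j k)), Finset.sum_comm]
  refine Finset.sum_congr rfl fun l _ => ?_
  rw [Finset.sum_mul]
  refine Finset.sum_congr rfl fun k _ => ?_
  rw [ProbabilityTheory.covariance_const_mul_left, ProbabilityTheory.covariance_const_mul_right]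
  ring

theorem integrable_prod_of_memLp {ι : Type*} [IsProbabilityMeasure μ] {d : ℕ} {f : ι → Ω → ℝ}
    {s : Finset ι} (hs : s.card ≤ d) (hf : ∀ k ∈ s, MemLp (f k) d μ) :
    Integrable (fun ω => ∏ k ∈ s, f k ω) μ := by
  rw [← memLp_one_iff_integrable]
  refine (MemLp.prod' hf).mono_exponent ?_
  rw [Finset.sum_const, nsmul_eq_mul, ENNReal.one_le_inv, ← div_eq_mul_inv]
  refine ENNReal.div_le_of_le_mul ?_
  rw [one_mul]
  exact_mod_cast hs

section Blocks

variable {ι κ : Type*} [Fintype ι] [DecidableEq ι] (π : Finpartition (Finset.univ : Finset ι))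

/-- The block of `π` that contains `k`, as an element of the type of blocks. -/
def blockOf (k : ι) : π.parts := ⟨π.part k, π.part_mem.2 (Finset.mem_univ k)⟩

theorem prod_prod_eq_prod_blockOf {M : Type*} [CommMonoid M] (f : π.parts → ι → M) :
    ∏ B : π.parts, ∏ k ∈ B.1, f B k = ∏ k, f (blockOf π k) k := by
  rw [← Finset.prod_fiberwise Finset.univ (blockOf π)]
  refine Finset.prod_congr rfl fun B _ => ?_
  have hB : Finset.univ.filter (fun k => blockOf π k = B) = B.1 := by
    ext k
    simp only [blockOf, Finset.mem_filter, Finset.mem_univ, true_and, ← Subtype.coe_inj]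
    exact ⟨fun h => h ▸ π.mem_part_self.2 (Finset.mem_univ k), π.part_eq_of_mem B.2⟩
  rw [← hB]
  refine Finset.prod_congr rfl fun k hk => ?_
  rw [(Finset.mem_filter.1 hk).2]

/-- Giving each block its own independent copy of `ω` turns the product of moments into one
integral, which is linear in each `f k`. -/
theorem prod_integral_eq_integral_pi [SigmaFinite μ] (f : ι → Ω → ℝ) :
    ∏ B ∈ π.parts, ∫ ω, ∏ k ∈ B, f k ω ∂μ =
      ∫ ω : π.parts → Ω, ∏ k, f k (ω (blockOf π k)) ∂Measure.pi fun _ => μ := by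
  rw [← Finset.prod_coe_sort, ← integral_fintype_prod_eq_prod]
  exact integral_congr_ae (.of_forall fun ω => prod_prod_eq_prod_blockOf π fun B k => f k (ω B))

theorem integrable_pi_prod_blockOf [IsProbabilityMeasure μ] {f : ι → Ω → ℝ}
    (hf : ∀ k, MemLp (f k) (Fintype.card ι) μ) :
    Integrable (fun ω : π.parts → Ω => ∏ k, f k (ω (blockOf π k))) (Measure.pi fun _ => μ) := by
  have hB : ∀ B : π.parts, Integrable (fun ω => ∏ k ∈ B.1, f k ω) μ := fun B =>
    integrable_prod_of_memLp (Finset.card_le_univ _) fun k _ => hf k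
  refine (Integrable.fintype_prod hB).congr (.of_forall fun ω => ?_)
  exact prod_prod_eq_prod_blockOf π fun B k => f k (ω B)

theorem prod_integral_prod_sum [Fintype κ] [IsProbabilityMeasure μ] (c : ι → κ → ℝ)
    {z : κ → Ω → ℝ} (hz : ∀ j, MemLp (z j) (Fintype.card ι) μ) :
    ∏ B ∈ π.parts, ∫ ω, ∏ k ∈ B, ∑ j, c k j * z j ω ∂μ =
      ∑ j : ι → κ, (∏ k, c k (j k)) * ∏ B ∈ π.parts, ∫ ω, ∏ k ∈ B, z (j k) ω ∂μ := by
  rw [prod_integral_eq_integral_pi π fun k ω => ∑ j, c k j * z j ω]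
  calc
    _ = ∫ ω : π.parts → Ω, ∑ j : ι → κ, (∏ k, c k (j k)) * ∏ k, z (j k) (ω (blockOf π k))
          ∂Measure.pi fun _ => μ := by
      simp only [Finset.prod_univ_sum, Fintype.piFinset_univ, Finset.prod_mul_distrib]
    _ = ∑ j : ι → κ, (∏ k, c k (j k)) *
          ∫ ω : π.parts → Ω, ∏ k, z (j k) (ω (blockOf π k)) ∂Measure.pi fun _ => μ := by
      rw [integral_finsetSum _ fun j _ =>
        (integrable_pi_prod_blockOf π fun k => hz (j k)).const_mul _]
      simp only [integral_const_mul]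
    _ = _ := Finset.sum_congr rfl fun j _ => by
      rw [prod_integral_eq_integral_pi π fun k => z (j k)]

end Blocks

variable {m n d : ℕ}

/-- Multiplication of a tensor by the matrix `M` along every mode. -/
def tensorAct (M : Matrix (Fin m) (Fin n) ℝ) (T : Tensor n d) : Tensor m d :=
  fun i => ∑ j : Fin d → Fin n, (∏ k, M (i k) (j k)) * T j

theorem cumulant_mulVec [IsProbabilityMeasure μ] (M : Matrix (Fin m) (Fin n) ℝ)
    {z : Ω → Fin n → ℝ} (hz : ∀ i, MemLp (fun ω => z ω i) d μ) :
    cumulant d μ (fun ω => M.mulVec (z ω)) = tensorAct M (cumulant d μ z) := by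
  funext i
  simp only [cumulant, tensorAct, Matrix.mulVec, dotProduct, Finset.mul_sum]
  rw [Finset.sum_comm]
  refine Finset.sum_congr rfl fun π _ => ?_
  rw [prod_integral_prod_sum π (fun k => M (i k)) (z := fun j ω => z ω j) (by simpa using hz),
    Finset.mul_sum]
  exact Finset.sum_congr rfl fun j _ => mul_left_comm _ _ _

theorem tensorAct_tensorAct {l : ℕ} (M : Matrix (Fin l) (Fin m) ℝ) (N : Matrix (Fin m) (Fin n) ℝ)
    (T : Tensor n d) : tensorAct M (tensorAct N T) = tensorAct (M * N) T := by
  funext i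
  simp only [tensorAct, Matrix.mul_apply, Finset.mul_sum]
  rw [Finset.sum_comm]
  refine Finset.sum_congr rfl fun j _ => ?_
  rw [Finset.prod_univ_sum, Finset.sum_mul, Fintype.piFinset_univ]
  refine Finset.sum_congr rfl fun k _ => ?_
  rw [Finset.prod_mul_distrib, mul_assoc]

theorem tensorAct_one (T : Tensor n d) : tensorAct 1 T = T := by
  funext i
  rw [tensorAct, Finset.sum_eq_single i _ (by simp)]
  · simp
  · intro j _ hj
    obtain ⟨k, hk⟩ := Function.ne_iff.1 hj
    have hik : (1 : Matrix (Fin n) (Fin n) ℝ) (i k) (j k) = 0 := Matrix.one_apply_ne hk.symm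
    rw [Finset.prod_eq_zero (Finset.mem_univ k) hik, zero_mul]

end Cumulants

section Forms

open MvPolynomial

variable {κ R S ι : Type*} [CommRing R] [CommRing S] {m : ℕ}

/-- The tensor `T(e_k, ·, …, ·)` of one order less. -/
def slice (T : (Fin (m + 1) → κ) → R) (k : κ) : (Fin m → κ) → R := fun i => T (Fin.cons k i)

section

variable [Fintype κ]

/-- The value `T(u, …, u)` of the form of degree `m` that corresponds to `T`. -/
def form (T : (Fin m → κ) → R) (u : κ → R) : R := ∑ i, T i * ∏ a, u (i a)

/-- The vector `T(·, u, …, u)`. -/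
def contract (T : (Fin (m + 1) → κ) → R) (u : κ → R) (k : κ) : R := form (slice T k) u

/-- `u` is parallel to `T(·, u, …, u)`; in particular, `0` counts as an eigenvector. -/
def IsEigenvector (T : (Fin (m + 1) → κ) → R) (u : κ → R) : Prop :=
  ∀ k l, u k * contract T u l = u l * contract T u k

/-- Coefficients, themselves forms of degree `m - 1` in `u`, that express
`T(u, …, u) - T(e_j, …, e_j) * u j ^ m` as a linear combination of the `u l` with `l ≠ j`. -/
def formQuotient (j : κ) (u : κ → R) : {m : ℕ} → ((Fin m → κ) → R) → κ → R
  | 0, _, _ => 0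
  | _ + 1, T, l => form (slice T l) u + u j * formQuotient j u (slice T j) l

theorem sum_eq_sum_sum_cons {M : Type*} [AddCommMonoid M] (f : (Fin (m + 1) → κ) → M) :
    ∑ i, f i = ∑ k, ∑ i : Fin m → κ, f (Fin.cons k i) := by
  rw [← (Fin.consEquiv fun _ : Fin (m + 1) => κ).sum_comp, Fintype.sum_prod_type]
  rfl

theorem form_eq_sum_slice (T : (Fin (m + 1) → κ) → R) (u : κ → R) :
    form T u = ∑ k, u k * form (slice T k) u := by
  rw [form, sum_eq_sum_sum_cons]
  refine Finset.sum_congr rfl fun k _ => ?_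
  rw [form, Finset.mul_sum]
  refine Finset.sum_congr rfl fun i _ => ?_
  simp only [Fin.prod_univ_succ, Fin.cons_zero, Fin.cons_succ, slice]
  ring

theorem form_eq_add_sum_formQuotient [DecidableEq κ] (T : (Fin m → κ) → R) (u : κ → R) (j : κ) :
    form T u = T (fun _ => j) * u j ^ m + ∑ l : {l // l ≠ j}, u l * formQuotient j u T l := by
  induction m with
  | zero => simp [form, formQuotient, Subsingleton.elim (default : Fin 0 → κ) fun _ => j]
  | succ m ih =>
    have hslice : slice T j (fun _ => j) = T fun _ => j :=
      congrArg T (funext (Fin.cases rfl fun _ => rfl))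
    rw [form_eq_sum_slice, Fintype.sum_eq_add_sum_subtype_ne _ j, ih, hslice]
    simp only [formQuotient, mul_add, Finset.sum_add_distrib, Finset.mul_sum]
    simp only [mul_left_comm (u j)]
    ring

theorem form_single [DecidableEq κ] (T : (Fin m → κ) → R) (j : κ) (c : R) :
    form T (Pi.single j c) = T (fun _ => j) * c ^ m := by
  rw [form_eq_add_sum_formQuotient T _ j, Pi.single_eq_same, add_eq_left]
  exact Finset.sum_eq_zero fun l _ => by rw [Pi.single_eq_of_ne l.2, zero_mul]

theorem map_form (φ : R →+* S) (T : (Fin m → κ) → R) (u : κ → R) :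
    φ (form T u) = form (φ ∘ T) (φ ∘ u) := by
  simp [form, map_sum, map_prod]

theorem map_contract (φ : R →+* S) (T : (Fin (m + 1) → κ) → R) (u : κ → R) (k : κ) :
    φ (contract T u k) = contract (φ ∘ T) (φ ∘ u) k :=
  map_form φ _ u

theorem map_formQuotient (φ : R →+* S) (j : κ) (u : κ → R) (T : (Fin m → κ) → R) (l : κ) :
    φ (formQuotient j u T l) = formQuotient j (φ ∘ u) (φ ∘ T) l := by
  induction m with
  | zero => simp [formQuotient]
  | succ m ih =>
    rw [formQuotient, map_add, map_mul, map_form, ih]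
    rfl

theorem formQuotient_zero (j : κ) (u : κ → R) (l : κ) :
    formQuotient j u (0 : (Fin m → κ) → R) l = 0 := by
  induction m with
  | zero => rfl
  | succ m ih =>
    have hslice : ∀ k, slice (0 : (Fin (m + 1) → κ) → R) k = 0 := fun _ => rfl
    simp [formQuotient, hslice, ih, form]

theorem isHomogeneous_form {T : (Fin m → κ) → MvPolynomial ι R} {u : κ → MvPolynomial ι R}
    (hu : ∀ l, (u l).IsHomogeneous 1) (hT : ∀ i, (T i).IsHomogeneous 0) :
    (form T u).IsHomogeneous m := by
  refine IsHomogeneous.sum _ _ _ fun i _ => ?_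
  simpa using (hT i).mul (IsHomogeneous.prod Finset.univ _ (fun _ => 1) fun a _ => hu (i a))

theorem isHomogeneous_formQuotient {T : (Fin (m + 1) → κ) → MvPolynomial ι R}
    {u : κ → MvPolynomial ι R} (hu : ∀ l, (u l).IsHomogeneous 1)
    (hT : ∀ i, (T i).IsHomogeneous 0) (j l : κ) : (formQuotient j u T l).IsHomogeneous m := by
  induction m with
  | zero => simpa [formQuotient] using isHomogeneous_form hu (T := slice T l) fun i => hT _
  | succ m ih =>
    refine (isHomogeneous_form hu (T := slice T l) fun i => hT _).add ?_
    simpa [add_comm] using (hu j).mul (ih (T := slice T j) fun i => hT _)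

end

theorem isHomogeneous_det [Fintype κ] [DecidableEq κ] {M : Matrix κ κ (MvPolynomial ι R)} {r : ℕ}
    (hM : ∀ k l, (M k l).IsHomogeneous r) : M.det.IsHomogeneous (Fintype.card κ * r) := by
  rw [Matrix.det_apply']
  refine IsHomogeneous.sum _ _ _ fun σ _ => ?_
  have hprod := IsHomogeneous.prod Finset.univ (fun k => M (σ k) k) (fun _ => r) fun k _ => hM _ _
  rw [Finset.sum_const, Finset.card_univ, smul_eq_mul] at hprod
  have hsign : ((Equiv.Perm.sign σ : ℤ) : MvPolynomial ι R) = C ((Equiv.Perm.sign σ : ℤ) : R) := by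
    simp
  rw [hsign]
  exact hprod.C_mul _

section Saturation

variable [Fintype κ] [DecidableEq κ]

/-- If `u` is an eigenvector of a tensor `T` with `T(e_k, e_j, …, e_j) = 0` for all `k ≠ j`, then
this matrix has in its kernel the vector of the coordinates `u l` with `l ≠ j`. Its determinant thus
vanishes unless `u` is a multiple of `e_j`: a closed condition that replaces the open condition that
`u` is not a multiple of `e_j`. -/
def saturationMatrix (T : (Fin (m + 1) → κ) → R) (u : κ → R) (j : κ) :
    Matrix {l // l ≠ j} {l // l ≠ j} R :=
  Matrix.of (fun k l : {l // l ≠ j} => u j * formQuotient j u (slice T k) l) - contract T u j • 1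

theorem saturationMatrix_mulVec {T : (Fin (m + 1) → κ) → R} {u : κ → R} {j : κ}
    (hT : ∀ k, k ≠ j → T (Fin.cons k fun _ => j) = 0) (hu : IsEigenvector T u) :
    (saturationMatrix T u j).mulVec (fun l => u l) = 0 := by
  funext k
  have hcontract : ∑ l : {l // l ≠ j}, u l * formQuotient j u (slice T k) l = contract T u k := by
    rw [contract, form_eq_add_sum_formQuotient (slice T k) u j, slice, hT k k.2, zero_mul, zero_add]
  rw [saturationMatrix, Matrix.sub_mulVec, Matrix.smul_mulVec, Matrix.one_mulVec, Pi.sub_apply,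
    Pi.smul_apply, smul_eq_mul, mul_comm _ (u k), hu k j, ← hcontract, Finset.mul_sum]
  exact sub_eq_zero.2 (Finset.sum_congr rfl fun l _ => by simp only [Matrix.of_apply]; ring)

theorem det_saturationMatrix_eq_zero [IsDomain R] {T : (Fin (m + 1) → κ) → R} {u : κ → R} {j : κ}
    (hT : ∀ k, k ≠ j → T (Fin.cons k fun _ => j) = 0) (hu : IsEigenvector T u)
    (huj : ∃ l, l ≠ j ∧ u l ≠ 0) : (saturationMatrix T u j).det = 0 := by
  obtain ⟨l, hl, hul⟩ := huj
  exact Matrix.exists_mulVec_eq_zero_iff.1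
    ⟨_, fun h => hul (congrFun h ⟨l, hl⟩), saturationMatrix_mulVec hT hu⟩

theorem map_det_saturationMatrix (φ : R →+* S) (T : (Fin (m + 1) → κ) → R) (u : κ → R) (j : κ) :
    φ (saturationMatrix T u j).det = (saturationMatrix (φ ∘ T) (φ ∘ u) j).det := by
  rw [RingHom.map_det]
  congr 1
  ext k l
  have hslice : φ ∘ slice T k = slice (φ ∘ T) k := rfl
  simp [saturationMatrix, Matrix.one_apply, apply_ite φ, map_contract, map_formQuotient, hslice]

theorem isHomogeneous_det_saturationMatrix {T : (Fin (m + 2) → κ) → MvPolynomial ι R}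
    {u : κ → MvPolynomial ι R} (hu : ∀ l, (u l).IsHomogeneous 1) (hT : ∀ i, (T i).IsHomogeneous 0)
    (j : κ) :
    (saturationMatrix T u j).det.IsHomogeneous (Fintype.card {l // l ≠ j} * (m + 1)) := by
  refine isHomogeneous_det fun k l => ?_
  have hcontract : (contract T u j).IsHomogeneous (m + 1) := isHomogeneous_form hu fun i => hT _
  have hquot := (hu j).mul (isHomogeneous_formQuotient hu (T := slice T k) (fun i => hT _) j l)
  rw [add_comm 1 m] at hquot
  simp only [saturationMatrix, Matrix.sub_apply, Matrix.of_apply, Matrix.smul_apply,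
    Matrix.one_apply, smul_eq_mul, mul_ite, mul_one, mul_zero]
  refine hquot.sub ?_
  split_ifs
  exacts [hcontract, isHomogeneous_zero _ _ _]

end Saturation

end Forms

section Diagonal

variable {κ R S : Type*} [DecidableEq κ] [CommRing R] [CommRing S] {m : ℕ}

/-- The diagonal tensor with diagonal entries `w`. -/
def diagTensor (w : κ → R) : (Fin (m + 1) → κ) → R :=
  fun i => if i = fun _ => i 0 then w (i 0) else 0

theorem diagTensor_const (w : κ → R) (k : κ) :
    diagTensor w (fun _ : Fin (m + 1) => k) = w k := if_pos rfl

theorem diagTensor_of_ne (w : κ → R) {i : Fin (m + 1) → κ} {a b : Fin (m + 1)} (h : i a ≠ i b) :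
    diagTensor w i = 0 := by
  refine if_neg fun hi => h ?_
  rw [hi]

theorem map_diagTensor (φ : R →+* S) (w : κ → R) :
    φ ∘ (diagTensor w : (Fin (m + 1) → κ) → R) = diagTensor (φ ∘ w) := by
  funext i
  simp [diagTensor, apply_ite φ]

theorem diagTensor_mem_diagSpace {n : ℕ} (w : Fin n → ℝ) :
    (diagTensor w : Tensor n (m + 1)) ∈ diagSpace n (m + 1) := by
  refine ⟨fun τ i => ?_, fun i hi a b => by_contra fun hab => hi (diagTensor_of_ne w hab)⟩
  by_cases hi : ∃ a, i a ≠ i 0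
  · obtain ⟨a, ha⟩ := hi
    have haτ : (i ∘ τ) (τ.symm a) ≠ (i ∘ τ) (τ.symm 0) := by simpa using ha
    rw [diagTensor_of_ne w ha, diagTensor_of_ne w haτ]
  · push Not at hi
    rw [show i = fun _ => i 0 from funext hi]
    rfl

variable [Fintype κ]

theorem contract_diagTensor (w u : κ → R) (k : κ) :
    contract (diagTensor w : (Fin (m + 1) → κ) → R) u k = w k * u k ^ m := by
  rw [contract, form, Finset.sum_eq_single fun _ => k]
  · have hcons : (Fin.cons k fun _ => k : Fin (m + 1) → κ) = fun _ => k :=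
      funext (Fin.cases rfl fun _ => rfl)
    simp [slice, hcons, diagTensor_const]
  · intro i _ hi
    obtain ⟨a, ha⟩ := Function.ne_iff.1 hi
    rw [slice, diagTensor_of_ne w (a := a.succ) (b := 0) (by simpa using ha), zero_mul]
  · simp

theorem formQuotient_slice_diagTensor_single (w : κ → R) {j k l : κ} (hk : k ≠ j) (hl : l ≠ j)
    (c : R) :
    formQuotient j (Pi.single j c)
      (slice (diagTensor w : (Fin (m + 3) → κ) → R) k) l = 0 := by
  have hslice : slice (slice (diagTensor w : (Fin (m + 3) → κ) → R) k) j = 0 :=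
    funext fun i => diagTensor_of_ne w (a := 0) (b := 1) hk
  have hentry : slice (slice (diagTensor w : (Fin (m + 3) → κ) → R) k) l (fun _ => j) = 0 :=
    diagTensor_of_ne w (a := 1) (b := 2) hl
  rw [formQuotient, hslice, formQuotient_zero, form_single, hentry, zero_mul, mul_zero, add_zero]

theorem det_saturationMatrix_diagTensor_single_ne_zero [IsDomain R] {w : κ → R} {j : κ}
    (hw : w j ≠ 0) {c : R} (hc : c ≠ 0) :
    (saturationMatrix (diagTensor w : (Fin (m + 3) → κ) → R) (Pi.single j c) j).det ≠ 0 := by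
  have hquot : (Matrix.of fun k l : {l // l ≠ j} => (Pi.single j c : κ → R) j *
      formQuotient j (Pi.single j c) (slice (diagTensor w : (Fin (m + 3) → κ) → R) k) l) = 0 := by
    ext k l
    simp [formQuotient_slice_diagTensor_single w k.2 l.2]
  rw [saturationMatrix, hquot, zero_sub, contract_diagTensor, Pi.single_eq_same, ← neg_smul,
    Matrix.det_smul, Matrix.det_one, mul_one]
  exact pow_ne_zero _ (neg_ne_zero.2 (mul_ne_zero hw (pow_ne_zero _ hc)))

theorem IsEigenvector.diagTensor_mul_pow_eq [IsDomain R] {w u : κ → R}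
    (hu : IsEigenvector (diagTensor w : (Fin (m + 2) → κ) → R) u) {k l : κ} (hk : u k ≠ 0)
    (hl : u l ≠ 0) : w k * u k ^ m = w l * u l ^ m := by
  have h := hu k l
  rw [contract_diagTensor, contract_diagTensor] at h
  refine mul_left_cancel₀ (mul_ne_zero hk hl) ?_
  linear_combination -h

end Diagonal

section Lacunary

theorem sum_ne_zero_of_norm_eq_mul_pow {ι E : Type*} [SeminormedAddCommGroup E] {s : Finset ι}
    (hs : s.Nonempty) {f : ι → ℕ} (hf : Set.InjOn f s) {b : ℕ} (hb : 2 ≤ b) {c : ℝ}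
    (hc : 0 < c) {a : ι → E} (ha : ∀ i ∈ s, ‖a i‖ = c * b ^ f i) : ∑ i ∈ s, a i ≠ 0 := by
  classical
  obtain ⟨j, hj, hmax⟩ := s.exists_max_image f hs
  intro hsum
  have hlt : ∑ i ∈ s.erase j, b ^ f i < b ^ f j := by
    rw [← Finset.sum_image (f := fun k => b ^ k) (hf.mono (Finset.erase_subset j s))]
    refine Nat.geomSum_lt hb fun k hk => ?_
    obtain ⟨i, hi, rfl⟩ := Finset.mem_image.1 hk
    have his := Finset.mem_of_mem_erase hi
    exact (hmax i his).lt_of_ne fun h => Finset.ne_of_mem_erase hi (hf his hj h)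
  have hle : ‖a j‖ ≤ c * ∑ i ∈ s.erase j, (b : ℝ) ^ f i := by
    rw [← Finset.add_sum_erase s a hj, add_eq_zero_iff_eq_neg] at hsum
    rw [hsum, norm_neg, Finset.mul_sum]
    exact norm_sum_le_of_le _ fun i hi => (ha i (Finset.mem_of_mem_erase hi)).le
  rw [ha j hj] at hle
  exact (le_of_mul_le_mul_left hle hc).not_gt (by exact_mod_cast hlt)

end Lacunary

section Base

variable {m n : ℕ}

/-- The diagonal entries of the tensor of order `m + 3` at which the elimination starts. They are
chosen so that the coordinates of an eigenvector have moduli proportional to powers of two. -/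
noncomputable def baseWeight (m : ℕ) (k : Fin n) : ℝ := ((2 : ℝ) ^ (k : ℕ))⁻¹ ^ (m + 1)

theorem baseWeight_ne_zero (m : ℕ) (k : Fin n) : baseWeight m k ≠ 0 := by
  unfold baseWeight
  positivity

/-- The complexification of the diagonal tensor with diagonal entries `baseWeight m`. -/
noncomputable def complexBaseTensor (m n : ℕ) : (Fin (m + 3) → Fin n) → ℂ :=
  diagTensor fun k => (baseWeight m k : ℂ)

theorem exists_norm_eq_mul_two_pow {u : Fin n → ℂ} (hu : IsEigenvector (complexBaseTensor m n) u) :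
    ∃ c > 0, ∀ k, u k ≠ 0 → ‖u k‖ = c * 2 ^ (k : ℕ) := by
  by_cases h0 : ∃ j, u j ≠ 0
  · obtain ⟨j, hj⟩ := h0
    refine ⟨(2 ^ (j : ℕ))⁻¹ * ‖u j‖, by positivity, fun k hk => ?_⟩
    have hpow : ((2 ^ (k : ℕ))⁻¹ * ‖u k‖) ^ (m + 1) = ((2 ^ (j : ℕ))⁻¹ * ‖u j‖) ^ (m + 1) := by
      simpa [baseWeight, mul_pow] using congrArg (‖·‖) (hu.diagTensor_mul_pow_eq hk hj)
    rw [← (pow_left_inj₀ (by positivity) (by positivity) m.succ_ne_zero).1 hpow]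
    field_simp
  · exact ⟨1, one_pos, fun k hk => (h0 ⟨k, hk⟩).elim⟩

theorem mul_eq_zero_of_dotProduct_eq_zero {u v : Fin n → ℂ}
    (hu : IsEigenvector (complexBaseTensor m n) u) (hv : IsEigenvector (complexBaseTensor m n) v)
    (huv : u ⬝ᵥ v = 0) (k : Fin n) : u k * v k = 0 := by
  obtain ⟨c, hc, hcu⟩ := exists_norm_eq_mul_two_pow hu
  obtain ⟨c', hc', hcv⟩ := exists_norm_eq_mul_two_pow hv
  by_contra hk
  refine sum_ne_zero_of_norm_eq_mul_pow (s := {k | u k * v k ≠ 0}) (a := fun k => u k * v k)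
    ⟨k, by simpa using hk⟩ Fin.val_injective.injOn (b := 4) (by norm_num) (mul_pos hc hc')
    (fun l hl => ?_) ?_
  · have hl : u l * v l ≠ 0 := by simpa using hl
    rw [norm_mul, hcu l (left_ne_zero_of_mul hl), hcv l (right_ne_zero_of_mul hl), mul_mul_mul_comm,
      ← mul_pow]
    norm_num
  · rw [Finset.sum_filter_ne_zero]
    exact huv

theorem exists_eq_single_of_dotProduct_eq_zero {Q : Matrix (Fin n) (Fin n) ℂ}
    (hQ : ∀ b, IsEigenvector (complexBaseTensor m n) (Q.col b))
    (hne : ∀ b, Q.col b ≠ 0) (horth : ∀ b c, b ≠ c → Q.col b ⬝ᵥ Q.col c = 0) (a : Fin n) :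
    ∃ j c, c ≠ 0 ∧ Q.col a = Pi.single j c := by
  choose f hf using fun b => Function.ne_iff.1 (hne b)
  have hdisj : ∀ k b c, b ≠ c → Q k b * Q k c = 0 := fun k b c hbc =>
    mul_eq_zero_of_dotProduct_eq_zero (hQ b) (hQ c) (horth b c hbc) k
  have hinj : Function.Injective f := fun b c hbc => by_contra fun h =>
    mul_ne_zero (hf b) (hbc ▸ hf c) (hdisj (f b) b c h)
  refine ⟨f a, Q (f a) a, hf a, funext fun k => ?_⟩
  obtain ⟨b, rfl⟩ := Finite.surjective_of_injective hinj k
  by_cases hab : a = b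
  · simp [hab]
  · rw [Pi.single_eq_of_ne (hinj.ne (Ne.symm hab))]
    exact (mul_eq_zero.1 (hdisj (f b) a b hab)).resolve_right (hf b)

theorem eq_zero_of_isEigenvector_complexBaseTensor {Q : Matrix (Fin n) (Fin n) ℂ} (a : Fin n)
    (hQ : ∀ b, IsEigenvector (complexBaseTensor m n) (Q.col b))
    (horth : Q.transpose * Q = (Q.transpose * Q) a a • 1)
    (hdet : ∀ j, (saturationMatrix (complexBaseTensor m n) (Q.col a) j).det = 0) : Q = 0 := by
  have hdot : ∀ b c, Q.col b ⬝ᵥ Q.col c = if b = c then Q.col a ⬝ᵥ Q.col a else 0 := fun b c =>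
    (congrFun (congrFun horth b) c).trans (by simp [Matrix.one_apply, Matrix.mul_apply, dotProduct])
  by_cases hzero : ∃ b, Q.col b = 0
  · obtain ⟨b, hb⟩ := hzero
    have hisotropic : Q.col a ⬝ᵥ Q.col a = 0 := by simpa [hb] using (hdot b b).symm
    ext k c
    exact mul_self_eq_zero.1
      (mul_eq_zero_of_dotProduct_eq_zero (hQ c) (hQ c) (by rw [hdot, hisotropic, ite_self]) k)
  · push Not at hzero
    obtain ⟨j, c, hc, hj⟩ :=
      exists_eq_single_of_dotProduct_eq_zero hQ hzero (fun b c h => by rw [hdot, if_neg h]) a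
    refine absurd (hj ▸ hdet j) (det_saturationMatrix_diagTensor_single_ne_zero ?_ hc)
    exact_mod_cast baseWeight_ne_zero m j

end Base

section Frame

open MvPolynomial

variable {κ R S : Type*} [Fintype κ] [DecidableEq κ] [CommRing R] [CommRing S] {m n : ℕ}

/-- The polynomial system in the entries of `T` and `Q` that is eliminated: the columns of `Q` are
eigenvectors of `T`, they are pairwise orthogonal and of the same square length as column `a`, and
column `a` satisfies the determinantal conditions of `saturationMatrix`. -/
def frameEquations (T : (Fin (m + 1) → κ) → R) (Q : Matrix κ κ R) (a : κ) :
    (κ × κ × κ) ⊕ (κ × κ) ⊕ κ → R :=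
  Sum.elim
    (fun (b, k, l) => Q.col b k * contract T (Q.col b) l - Q.col b l * contract T (Q.col b) k)
    (Sum.elim (fun (b, c) => (Q.transpose * Q) b c - if b = c then (Q.transpose * Q) a a else 0)
      fun j => (saturationMatrix T (Q.col a) j).det)

theorem frameEquations_eq_zero_iff {T : (Fin (m + 1) → κ) → R} {Q : Matrix κ κ R} {a : κ} :
    (∀ i, frameEquations T Q a i = 0) ↔
      (∀ b, IsEigenvector T (Q.col b)) ∧ Q.transpose * Q = (Q.transpose * Q) a a • 1 ∧
        ∀ j, (saturationMatrix T (Q.col a) j).det = 0 := by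
  simp [frameEquations, Sum.forall, Prod.forall, sub_eq_zero, IsEigenvector, ← Matrix.ext_iff,
    Matrix.one_apply]

theorem map_frameEquations (φ : R →+* S) (T : (Fin (m + 1) → κ) → R) (Q : Matrix κ κ R) (a : κ)
    (i : (κ × κ × κ) ⊕ (κ × κ) ⊕ κ) :
    φ (frameEquations T Q a i) = frameEquations (φ ∘ T) (Q.map φ) a i := by
  have hcol : ∀ b, φ ∘ Q.col b = (Q.map φ).col b := fun _ => rfl
  rcases i with ⟨b, k, l⟩ | ⟨b, c⟩ | j
  · simp [frameEquations, map_contract, hcol]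
  · simp [frameEquations, Matrix.mul_apply, apply_ite φ]
  · simp [frameEquations, map_det_saturationMatrix, hcol]

theorem exists_isHomogeneous_frameEquations {ι : Type*} {T : (Fin (m + 2) → κ) → MvPolynomial ι R}
    {Q : Matrix κ κ (MvPolynomial ι R)} (hT : ∀ i, (T i).IsHomogeneous 0)
    (hQ : ∀ k b, (Q k b).IsHomogeneous 1) (a : κ) (i : (κ × κ × κ) ⊕ (κ × κ) ⊕ κ) :
    ∃ r, (frameEquations T Q a i).IsHomogeneous r := by
  have hgram : ∀ b c, ((Q.transpose * Q) b c).IsHomogeneous 2 := fun b c =>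
    IsHomogeneous.sum _ _ _ fun k _ => (hQ k b).mul (hQ k c)
  rcases i with ⟨b, k, l⟩ | ⟨b, c⟩ | j
  · have hcontract : ∀ k, (contract T (Q.col b) k).IsHomogeneous (m + 1) := fun k =>
      isHomogeneous_form (fun l => hQ l b) fun i => hT _
    exact ⟨_, ((hQ k b).mul (hcontract l)).sub ((hQ l b).mul (hcontract k))⟩
  · refine ⟨2, (hgram b c).sub ?_⟩
    split_ifs
    exacts [hgram a a, isHomogeneous_zero _ _ _]
  · exact ⟨_, isHomogeneous_det_saturationMatrix (fun l => hQ l a) hT j⟩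

theorem evalAt_frameEquations (t : (Fin (m + 1) → κ) → R) (x : κ × κ → R) (a : κ)
    (i : (κ × κ × κ) ⊕ (κ × κ) ⊕ κ) :
    evalAt t x (frameEquations (fun i => C (X i)) (Matrix.mvPolynomialX κ κ _) a i) =
      frameEquations t (Matrix.of fun k b => x (k, b)) a i := by
  rw [map_frameEquations]
  congr 1
  · ext
    simp [evalAt]
  · ext
    simp [evalAt]

theorem exists_frame_eliminant (m : ℕ) (a : Fin n) :
    ∃ p : MvPolynomial (Fin (m + 3) → Fin n) ℝ, eval (diagTensor (baseWeight m)) p ≠ 0 ∧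
      ∀ T : Tensor n (m + 3), eval T p ≠ 0 → ∀ Q : Matrix (Fin n) (Fin n) ℝ,
        (∀ i, frameEquations T Q a i = 0) → Q = 0 := by
  have hbase : Complex.ofReal ∘ diagTensor (baseWeight m) = complexBaseTensor m n :=
    map_diagTensor Complex.ofRealHom (baseWeight m)
  obtain ⟨p, hp₀, hp⟩ := exists_eliminant _
    (exists_isHomogeneous_frameEquations (fun _ => isHomogeneous_C _ _)
      (fun _ _ => isHomogeneous_X _ _) a)
    (complexBaseTensor m n) fun x hx => by
      obtain ⟨hQ, horth, hdet⟩ := frameEquations_eq_zero_iff.1 fun i =>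
        (evalAt_frameEquations _ x a i).symm.trans (hx i)
      have := eq_zero_of_isEigenvector_complexBaseTensor a hQ horth hdet
      exact funext fun (k, b) => congrFun (congrFun this k) b
  obtain ⟨q, hq₀, hq⟩ :=
    exists_real_eval_ne_zero p (diagTensor (baseWeight m)) (by rwa [← hbase] at hp₀)
  refine ⟨q, hq₀, fun T hT Q hQ => ?_⟩
  have hzero := hp _ (fun kb => (Q kb.1 kb.2 : ℂ)) (hq T hT) fun i => by
    have hmap := map_frameEquations Complex.ofRealHom T Q a i
    rw [hQ i, map_zero] at hmap
    exact (evalAt_frameEquations _ _ a i).trans hmap.symm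
  ext k b
  exact Complex.ofReal_eq_zero.1 (congrFun hzero (k, b))

theorem pmiIndex_succ (i j : Fin n) : pmiIndex (m + 1) i j = Fin.cons i fun _ => j :=
  funext (Fin.cases rfl fun _ => rfl)

theorem exists_forall_orthogonal_eigenframe (m n : ℕ) :
    ∃ p : MvPolynomial (Fin (m + 3) → Fin n) ℝ, eval (diagTensor (baseWeight m)) p ≠ 0 ∧
      ∀ T ∈ pmiSpace n (m + 3), eval T p ≠ 0 → ∀ Q : Matrix (Fin n) (Fin n) ℝ,
        Q.transpose * Q = 1 → (∀ b, IsEigenvector T (Q.col b)) →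
        ∀ a, ∃ j, ∀ k, k ≠ j → Q k a = 0 := by
  choose p hp₀ hp using exists_frame_eliminant (n := n) m
  refine ⟨∏ a, p a, ?_, fun T hT hTp Q horth hQ a => ?_⟩
  · rw [eval_prod]
    exact Finset.prod_ne_zero_iff.2 fun a _ => hp₀ a
  · rw [eval_prod] at hTp
    by_contra! hne
    have hdet : ∀ j, (saturationMatrix T (Q.col a) j).det = 0 := fun j =>
      det_saturationMatrix_eq_zero (fun k hk => pmiIndex_succ k j ▸ hT.2 k j hk) (hQ a) (hne j)
    have hQ0 : Q = 0 := hp a T (Finset.prod_ne_zero_iff.1 hTp a (Finset.mem_univ a)) Q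
      (frameEquations_eq_zero_iff.2 ⟨hQ, by simp [horth], hdet⟩)
    simpa [hQ0] using congrFun (congrFun horth a) a

end Frame

section Identifiability

variable {m n d : ℕ}

theorem tensorAct_cons {l : ℕ} (M : Matrix (Fin l) (Fin n) ℝ) (T : Tensor n (m + 1))
    (a b : Fin l) : tensorAct M T (Fin.cons a fun _ => b) = M a ⬝ᵥ contract T (M b) := by
  rw [tensorAct, sum_eq_sum_sum_cons]
  refine Finset.sum_congr rfl fun k _ => ?_
  rw [contract, form, Finset.mul_sum]
  refine Finset.sum_congr rfl fun i _ => ?_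
  simp only [Fin.prod_univ_succ, Fin.cons_zero, Fin.cons_succ, slice]
  ring

theorem isEigenvector_col_of_tensorAct_mem_pmiSpace {T : Tensor n (m + 1)}
    {Q : Matrix (Fin n) (Fin n) ℝ} (hQ : Q.transpose * Q = 1)
    (hT : tensorAct Q.transpose T ∈ pmiSpace n (m + 1)) (b : Fin n) :
    IsEigenvector T (Q.col b) := by
  set v := contract T (Q.col b)
  have hdot : ∀ a, a ≠ b → Q.col a ⬝ᵥ v = 0 := fun a hab => by
    rw [← hT.2 a b hab, pmiIndex_succ, tensorAct_cons]
    rfl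
  have hv : v = (Q.col b ⬝ᵥ v) • Q.col b := by
    calc
      v = Q.mulVec (Q.transpose.mulVec v) := by
        rw [Matrix.mulVec_mulVec, mul_eq_one_comm.1 hQ, Matrix.one_mulVec]
      _ = Q.mulVec (Pi.single b (Q.col b ⬝ᵥ v)) := by
        congr 1
        funext a
        by_cases hab : a = b
        · subst hab
          rw [Pi.single_eq_same]
          rfl
        · rw [Pi.single_eq_of_ne hab]
          exact hdot a hab
      _ = _ := by simp
  intro k l
  change Q.col b k * v l = Q.col b l * v k
  rw [hv]
  simp only [Pi.smul_apply, smul_eq_mul]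
  ring

theorem exists_orthogonal_eq_mul {κ R : Type*} [Fintype κ] [DecidableEq κ] [CommRing R]
    {A B : Matrix κ κ R} (hA : IsUnit A) (hAB : B * B.transpose = A * A.transpose) :
    ∃ Q : Matrix κ κ R, Q.transpose * Q = 1 ∧ B = A * Q := by
  have hdet : IsUnit A.det := (Matrix.isUnit_iff_isUnit_det A).1 hA
  refine ⟨A⁻¹ * B, mul_eq_one_comm.1 ?_, (Matrix.mul_nonsing_inv_cancel_left A B hdet).symm⟩
  calc
    A⁻¹ * B * (A⁻¹ * B).transpose = A⁻¹ * (B * B.transpose) * A⁻¹.transpose := by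
      rw [Matrix.transpose_mul]
      simp only [Matrix.mul_assoc]
    _ = A.transpose * A.transpose⁻¹ := by
      rw [hAB, Matrix.nonsing_inv_mul_cancel_left A _ hdet, Matrix.transpose_nonsing_inv]
    _ = 1 := Matrix.mul_nonsing_inv _ (Matrix.isUnit_det_transpose A hdet)

theorem tensorAct_transpose_eq_of_tensorAct_mul_eq {A Q : Matrix (Fin n) (Fin n) ℝ}
    (hA : IsUnit A) (hQ : Q.transpose * Q = 1) {T T' : Tensor n d}
    (hT : tensorAct (A * Q) T' = tensorAct A T) : tensorAct Q.transpose T = T' := by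
  have hdet : IsUnit A.det := (Matrix.isUnit_iff_isUnit_det A).1 hA
  have h := congrArg (tensorAct (Q.transpose * A⁻¹)) hT
  rwa [tensorAct_tensorAct, tensorAct_tensorAct, Matrix.mul_assoc, Matrix.mul_assoc,
    Matrix.nonsing_inv_mul_cancel_left A Q hdet, hQ, tensorAct_one, Matrix.nonsing_inv_mul A hdet,
    Matrix.mul_one, eq_comm] at h

theorem eqUpToSignedPerm_mul_of_orthogonal (A : Matrix (Fin n) (Fin n) ℝ)
    {Q : Matrix (Fin n) (Fin n) ℝ} (hQ : Q.transpose * Q = 1)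
    (hsupp : ∀ a, ∃ j, ∀ k, k ≠ j → Q k a = 0) : EqUpToSignedPerm A (A * Q) := by
  choose f hf using hsupp
  have hgram : ∀ a b, Q (f a) a * Q (f a) b = (1 : Matrix (Fin n) (Fin n) ℝ) a b := fun a b => by
    rw [← hQ, Matrix.mul_apply, Finset.sum_eq_single (f a)]
    · rfl
    · intro k _ hk
      rw [Matrix.transpose_apply, hf a k hk, zero_mul]
    · simp
  have hsq : ∀ a, Q (f a) a * Q (f a) a = 1 := fun a => (hgram a a).trans (Matrix.one_apply_eq a)
  have hinj : Function.Injective f := fun a b hab => by_contra fun hne => by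
    have h := hgram a b
    rw [Matrix.one_apply_ne hne] at h
    have ha := hsq a
    have hb := hsq b
    rw [← hab] at hb
    rcases mul_eq_zero.1 h with h | h <;> simp [h] at ha hb
  refine ⟨Equiv.ofBijective f (Finite.injective_iff_bijective.1 hinj), fun a => Q (f a) a,
    fun a => mul_self_eq_one_iff.1 (hsq a), fun i a => ?_⟩
  rw [Matrix.mul_apply, Finset.sum_eq_single (f a)]
  · exact mul_comm _ _
  · intro k _ hk
    rw [hf a k hk, mul_zero]
  · simp

end Identifiability

end ComponentAnalysis

open ComponentAnalysis MvPolynomial in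
theorem theorem1p3_general (n d : ℕ) (hd : 3 ≤ d) :
    ∃ p : MvPolynomial (Fin d → Fin n) ℝ, (∃ T ∈ diagSpace n d, eval T p ≠ 0) ∧
      ∀ (Ω : Type*) [MeasurableSpace Ω] (μ : Measure Ω) [IsProbabilityMeasure μ]
        (s : Ω → Fin n → ℝ) (A : Matrix (Fin n) (Fin n) ℝ),
        IsSource (pmiSpace n d) μ s → eval (cumulant d μ s) p ≠ 0 → IsUnit A →
      ∀ (Ω' : Type*) [MeasurableSpace Ω'] (μ' : Measure Ω') [IsProbabilityMeasure μ']
        (s' : Ω' → Fin n → ℝ) (B : Matrix (Fin n) (Fin n) ℝ),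
        IsSource (pmiSpace n d) μ' s' →
        covMatrix μ' (fun ω => B.mulVec (s' ω)) = covMatrix μ (fun ω => A.mulVec (s ω)) →
        cumulant d μ' (fun ω => B.mulVec (s' ω)) = cumulant d μ (fun ω => A.mulVec (s ω)) →
        EqUpToSignedPerm A B := by
  obtain ⟨m, rfl⟩ := Nat.exists_eq_add_of_le' hd
  obtain ⟨p, hp₀, hp⟩ := exists_forall_orthogonal_eigenframe m n
  refine ⟨p, ⟨_, diagTensor_mem_diagSpace _, hp₀⟩, ?_⟩
  intro Ω _ μ _ s A hs hsp hA Ω' _ μ' _ s' B hs' hcov hcum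
  obtain ⟨Q, hQ, rfl⟩ : ∃ Q : Matrix (Fin n) (Fin n) ℝ, Q.transpose * Q = 1 ∧ B = A * Q := by
    refine exists_orthogonal_eq_mul hA ?_
    simpa [covMatrix_mulVec, hs.memLp_two (by lia), hs'.memLp_two (by lia), hs.cov_eq_one,
      hs'.cov_eq_one] using hcov
  rw [cumulant_mulVec _ hs.memLp, cumulant_mulVec _ hs'.memLp] at hcum
  have hT' := tensorAct_transpose_eq_of_tensorAct_mul_eq hA hQ hcum
  have heigen := isEigenvector_col_of_tensorAct_mem_pmiSpace hQ (hT' ▸ hs'.cumulant_mem)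
  exact eqUpToSignedPerm_mul_of_orthogonal A hQ (hp _ hs.cumulant_mem hsp Q hQ heigen)

open ComponentAnalysis in
theorem theorem1p3 (n d : ℕ) (hd : 3 ≤ d) (V : Submodule ℝ (Tensor n d))
    (hdiag : diagSpace n d ≤ V) (hpmi : V ≤ pmiSpace n d) :
    ForGeneric V fun T =>
      ∀ (Ω : Type*) [MeasurableSpace Ω] (μ : Measure Ω) [IsProbabilityMeasure μ]
        (s : Ω → Fin n → ℝ) (A : Matrix (Fin n) (Fin n) ℝ),
        IsSource V μ s → cumulant d μ s = T → IsUnit A →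
      ∀ (Ω' : Type*) [MeasurableSpace Ω'] (μ' : Measure Ω') [IsProbabilityMeasure μ']
        (s' : Ω' → Fin n → ℝ) (B : Matrix (Fin n) (Fin n) ℝ),
        IsSource V μ' s' → IsUnit B →
        covMatrix μ' (fun ω => B.mulVec (s' ω)) = covMatrix μ (fun ω => A.mulVec (s ω)) →
        cumulant d μ' (fun ω => B.mulVec (s' ω)) = cumulant d μ (fun ω => A.mulVec (s ω)) →
        EqUpToSignedPerm A B := by
  obtain ⟨p, ⟨T₀, hT₀, hpT₀⟩, hp⟩ := theorem1p3_general n d hd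
  exact ⟨p, ⟨T₀, hdiag hT₀, hpT₀⟩, fun T _ hpT Ω _ μ _ s A hs hT hA Ω' _ μ' _ s' B hs' _ =>
    hp Ω μ s A (hs.mono hpmi) (hT ▸ hpT) hA Ω' μ' s' B (hs'.mono hpmi)⟩
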